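/- In the Congested Clique model, the $n$ nodes of a fully connected synchronous network, with identifiers $1,\dots,n$, compute in rounds; in every round each node may send to every other node a (possibly different) message of $O(\log n)$ bits, and local computation is unrestricted. In a graph problem the nodes of the network are the nodes of the input graph $G$, and the input of each node is the set of its neighbours in $G$. There is a deterministic Congested Clique algorithm that, for every $n$ and every unweighted undirected simple graph $G$ on $n$ nodes, computes all-pairs shortest paths in $G$: every node $v$ halts and outputs the distances $d_G(v,u)$ for all nodes $u$ (with $d_G(v,u)=\infty$ if $u$ cannot be reached from $v$). If $G$ is connected, then all nodes have halted after $O\bigl(D\,((m/n)^{1/3}+1)\bigr)$ rounds, where $m$ is the number of edges of $G$ and $D$ is its diameter. The constants in both $O$-notations are absolute, and the algorithm is not given $m$ or $D$ in advance. -/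

import Mathlib

namespace CongestedClique

/-- A message of at most `B` bits; the empty list stands for silence. -/
abbrev Message (B : ℕ) : Type := {l : List Bool // l.length ≤ B}

/-- A deterministic algorithm for the clique on the nodes `0, …, n - 1` with a bandwidth of `B` bits
per message. Each node has an input of type `In`, and has to produce an output of type `Out`.
The initial state of a node depends on its identifier and its own input only. In every synchronous
round a node computes from its current state a message for each node, and passes to a new state that
depends on its current state and the messages it receives. Local computation is not restricted.
A node halts as soon as its state carries an output. -/
structure Algorithm (n B : ℕ) (In Out : Type) where
  State : Type
  init : Fin n → In → State
  send : State → Fin n → Message B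
  receive : State → (Fin n → Message B) → State
  output : State → Option Out

namespace Algorithm

variable {n B : ℕ} {In Out : Type} (A : Algorithm n B In Out)

/-- The message that a node in state `s` transmits to the node `v`; halted nodes are silent. -/
def transmit (s : A.State) (v : Fin n) : Message B :=
  match A.output s with
  | some _ => ⟨[], Nat.zero_le B⟩
  | none => A.send s v

/-- The new state of a node in state `s` that receives the messages `msg`
(`msg u` is the message from `u`); halted nodes do not change. -/
def step (s : A.State) (msg : Fin n → Message B) : A.State :=
  match A.output s with
  | some _ => s
  | none => A.receive s msg

/-- `A.run x t v` is the state of the node `v` after `t` rounds, if the input of every node `u`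
is `x u`. -/
def run (x : Fin n → In) : ℕ → Fin n → A.State
  | 0 => fun v => A.init v (x v)
  | t + 1 => fun v => A.step (run x t v) (fun u => A.transmit (run x t u) v)

/-- On the inputs `x`, after at most `T` rounds every node `v` has halted with the output `y v`. -/
def ComputesWithin (x : Fin n → In) (y : Fin n → Out) (T : ℕ) : Prop :=
  ∀ v, A.output (A.run x T v) = some (y v)

end Algorithm

end CongestedClique

/-! Breadth-first search runs from all nodes at once. A node is within distance t + 1 of u exactly
if it or one of its neighbours is within t, so a step is a Boolean product of the adjacency matrix
with the matrix of pairs at distance at most t. A step that changes nothing certifies that all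
distances are known, also in a disconnected graph; in a connected one D + 1 products suffice
(`runs_explore`).

A product takes O(q) rounds, where q is the least positive number with 2m ≤ n q³, so that q =
O((m/n)^{1/3} + 1) (`exists_cube_bound`, `cube_root_bound`). The triples (row, column, target) are
cut into cells by O(q) row classes, for each of these O(q) column classes, and about n/q² target
classes. These are O(n) cells, boundedly many per node. The classes are balanced in size and in
number of edges, so a cell involves O(nq) edges, matrix entries and results (`exists_feasible`).

Hence every node sends and receives O(nq) packets. The pattern depends only on degrees and class
counts, which are announced at the start, so all nodes know the same edge colouring of the bipartite
source-destination multigraph; n colours are delivered in two rounds, each through its own relay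
(`Routable.exists_isRouting`, `runs_route`). To keep the pattern public, an edge is addressed as the
l-th neighbour of w in a class; the neighbour itself is the payload. -/

namespace CongestedClique

/-! ### Synchronous programs and their simulation by algorithms -/

/-- A program of a node: in every round it sends a number below `n` to each node, and goes on
depending on the numbers it receives. -/
inductive Program (n : ℕ) (α : Type) : Type
  | ret (a : α) : Program n α
  | round (msg : Fin n → Fin n) (next : (Fin n → Fin n) → Program n α) : Program n α

namespace Program

variable {n : ℕ} {α β : Type}

/-- Sequential composition. -/
def bind : Program n α → (α → Program n β) → Program n β
  | ret a, f => f a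
  | round m k, f => round m fun r => (k r).bind f

/-- If every node `v` runs `p v`, then all nodes return after exactly `T` rounds, and `v` returns
`y v`. -/
inductive Runs : (Fin n → Program n α) → ℕ → (Fin n → α) → Prop
  | ret (y : Fin n → α) : Runs (fun v => .ret (y v)) 0 y
  | round (m : Fin n → Fin n → Fin n) (k : Fin n → (Fin n → Fin n) → Program n α) {T : ℕ}
      {y : Fin n → α} (h : Runs (fun v => k v fun u => m u v) T y) :
      Runs (fun v => .round (m v) (k v)) (T + 1) y

theorem Runs.bind {p : Fin n → Program n α} {T : ℕ} {y : Fin n → α} (h : Runs p T y)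
    {f : Fin n → α → Program n β} {T' : ℕ} {z : Fin n → β}
    (h' : Runs (fun v => f v (y v)) T' z) :
    Runs (fun v => (p v).bind (f v)) (T + T') z := by
  induction h with
  | ret y => simpa [Program.bind] using h'
  | round m k h ih =>
    rw [Nat.add_right_comm]
    exact Runs.round m (fun v r => (k v r).bind (f v)) (ih h')

theorem Runs.ret_of_eq {x y : Fin n → α} (h : ∀ v, x v = y v) :
    Runs (fun v => .ret (x v)) 0 y := by
  rw [← funext h]
  exact Runs.ret x

/-- One round of communication. -/
def exchange (msg : Fin n → Fin n) : Program n (Fin n → Fin n) := round msg ret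

theorem runs_exchange (m : Fin n → Fin n → Fin n) :
    Runs (fun v => exchange (m v)) 1 (fun v u => m u v) :=
  Runs.round m (fun _ => ret) (Runs.ret _)

/-- The programs `p 0, p 1, …` one after the other. -/
def sequence : {r : ℕ} → (Fin r → Program n α) → Program n (Fin r → α)
  | 0, _ => ret Fin.elim0
  | _ + 1, p => (p 0).bind fun a => (sequence fun i => p i.succ).bind fun f => ret (Fin.cons a f)

theorem runs_sequence {T : ℕ} : ∀ {r : ℕ} {p : Fin n → Fin r → Program n α}
    {y : Fin n → Fin r → α}, (∀ i, Runs (fun v => p v i) T fun v => y v i) →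
    Runs (fun v => sequence (p v)) (r * T) y
  | 0, p, y, _ => by
    have : y = fun _ => Fin.elim0 := by ext v i; exact i.elim0
    subst this
    simpa [sequence] using Runs.ret _
  | r + 1, p, y, h => by
    have h1 := runs_sequence (p := fun v i => p v (Fin.succ i)) (fun i => h i.succ)
    have h2 : Runs (fun v => (ret (Fin.cons (y v 0) fun i => y v (Fin.succ i)) :
        Program n (Fin (r + 1) → α))) 0 y := by
      have := Runs.ret y
      convert this using 3 with v
      exact Fin.cons_self_tail (y v)
    have := (h 0).bind (f := fun v a => (sequence fun i => p v (Fin.succ i)).bind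
      fun f => ret (Fin.cons (α := fun _ => α) a f))
      (h1.bind (f := fun v f => ret (Fin.cons (α := fun _ => α) (y v 0) f)) h2)
    have hT : (r + 1) * T = T + (r * T + 0) := by ring
    rw [hT]
    exact this

/-- The algorithm in which every node runs its program, with `enc` as the encoding of the numbers
below `n`. -/
def toAlgorithm {B : ℕ} {In Out : Type} (enc : Fin n → Message B) (dec : Message B → Fin n)
    (p : Fin n → In → Program n Out) : Algorithm n B In Out where
  State := Program n Out
  init := p
  send
    | ret _, _ => ⟨[], Nat.zero_le B⟩
    | round m _, u => enc (m u)
  receive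
    | ret a, _ => ret a
    | round _ k, r => k fun u => dec (r u)
  output
    | ret a => some a
    | round _ _ => none

theorem Runs.computesWithin {B : ℕ} {In Out : Type} {enc : Fin n → Message B}
    {dec : Message B → Fin n} (hdec : Function.LeftInverse dec enc)
    {p : Fin n → In → Program n Out} {x : Fin n → In} {T : ℕ} {y : Fin n → Out}
    (h : Runs (fun v => p v (x v)) T y) : (toAlgorithm enc dec p).ComputesWithin x y T := by
  set A := toAlgorithm enc dec p with hA
  -- An arbitrary starting time t lets the induction advance by a round.
  have key : ∀ {s : Fin n → Program n Out} {T : ℕ} {y : Fin n → Out}, Runs s T y →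
      ∀ t, A.run x t = s → ∀ v, A.output (A.run x (t + T) v) = some (y v) := by
    intro s T y hs
    induction hs with
    | ret y => intro t ht v; rw [Nat.add_zero, ht]; rfl
    | round m k h ih =>
      intro t ht v
      rw [Nat.add_comm _ 1, ← Nat.add_assoc]
      refine ih (t + 1) ?_ v
      funext v
      have hstep : A.run x (t + 1) v =
          A.step (A.run x t v) fun u => A.transmit (A.run x t u) v := rfl
      rw [hstep, ht]
      change k v (fun u => dec (enc (m u v))) = _
      simp only [hdec _]
  intro v
  simpa using key h 0 rfl v

end Program

theorem exists_encoding (n : ℕ) [NeZero n] : ∃ (enc : Fin n → Message (1 * Nat.clog 2 n))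
    (dec : Message (1 * Nat.clog 2 n) → Fin n), Function.LeftInverse dec enc := by
  let enc : Fin n → Message (1 * Nat.clog 2 n) := fun x => ⟨Nat.bits x, by
    rw [one_mul, Nat.size_eq_bits_len, Nat.size_le]
    exact x.2.trans_le (Nat.le_pow_clog one_lt_two n)⟩
  have hinj : Function.Injective enc := fun x y h => by
    have h1 : Nat.bits x = Nat.bits y := congrArg Subtype.val h
    apply Fin.ext
    rw [← Nat.digits_inj_iff (b := 2), Nat.digits_two_eq_bits, Nat.digits_two_eq_bits, h1]
  exact ⟨enc, Function.invFun enc, Function.leftInverse_invFun hinj⟩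

/-! ### Routing of publicly known packet patterns -/

section Routing

variable {n : ℕ} {E : Type}

/-- The value of `f` at an element with the property `S`. -/
noncomputable def pick [NeZero n] (S : E → Prop) (f : E → Fin n) : Fin n :=
  open Classical in if h : ∃ e, S e then f h.choose else 0

theorem pick_eq [NeZero n] {S : E → Prop} (f : E → Fin n) {e : E} (he : S e)
    (hu : ∀ e', S e' → e' = e) : pick S f = f e := by
  have h : ∃ e, S e := ⟨e, he⟩
  rw [pick, dif_pos h, hu _ h.choose_spec]

/-- Packets with equal colours have distinct sources and distinct destinations. -/
def IsRouting {R : ℕ} (src dst : E → Fin n) (χ : E → Fin R × Fin n) : Prop :=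
  (∀ e e', src e = src e' → χ e = χ e' → e = e') ∧ ∀ e e', dst e = dst e' → χ e = χ e' → e = e'

/-- Each node is the source of at most `R * n / 2` packets, and the destination of as many. -/
def Routable [Fintype E] (R : ℕ) (src dst : E → Fin n) : Prop :=
  ∃ L, 2 * L ≤ R * n ∧ (∀ x, Nat.card {e // src e = x} ≤ L) ∧ ∀ x, Nat.card {e // dst e = x} ≤ L

/-- Greedy colouring of the edges of a bipartite multigraph of maximum degree L; fewer than 2 * L
colours are ever needed. -/
theorem Routable.exists_isRouting [Fintype E] {R : ℕ} {src dst : E → Fin n}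
    (h : Routable R src dst) : ∃ χ : E → Fin R × Fin n, IsRouting src dst χ := by
  classical
  obtain ⟨L, hL, hs, hd⟩ := h
  rcases isEmpty_or_nonempty E with hE | ⟨⟨e₀⟩⟩
  · exact ⟨fun e => hE.elim e, fun e => hE.elim e, fun e => hE.elim e⟩
  have hcard : ∀ (g : E → Fin n), (∀ x, Nat.card {e // g e = x} ≤ L) → ∀ (S : Finset E) a, a ∉ S →
      (S.filter fun e => g e = g a).card + 1 ≤ L := by
    intro g hg S a ha
    refine le_trans ?_ (hg (g a))
    rw [Nat.card_eq_fintype_card, Fintype.card_subtype,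
      ← Finset.card_insert_of_notMem (s := S.filter fun e => g e = g a) (a := a) (by simp [ha])]
    refine Finset.card_le_card fun e he => ?_
    simp only [Finset.mem_insert, Finset.mem_filter] at he
    rcases he with rfl | he
    · simp
    · simp [he.2]
  have hC : Nonempty (Fin R × Fin n) := by
    have h1 := hcard src hs ∅ e₀ (by simp)
    have h2 : R ≠ 0 := by rintro rfl; simp at hL; omega
    exact ⟨⟨⟨0, by omega⟩, src e₀⟩⟩
  have key : ∀ S : Finset E, ∃ χ : E → Fin R × Fin n, ∀ e ∈ S, ∀ e' ∈ S,
      (src e = src e' ∨ dst e = dst e') → χ e = χ e' → e = e' := by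
    intro S
    induction S using Finset.induction_on with
    | empty => exact ⟨fun _ => hC.some, by simp⟩
    | insert a S ha ih =>
      obtain ⟨χ, hχ⟩ := ih
      have h1 := hcard src hs S a ha
      have h2 := hcard dst hd S a ha
      -- At most L - 1 coloured packets share the source of `a`, and at most L - 1 its destination,
      -- so fewer than R * n colours are forbidden.
      obtain ⟨b, hb⟩ : ∃ b, b ∉ (S.filter fun e => src e = src a ∨ dst e = dst a).image χ := by
        by_contra! hcon
        have h3 : (Finset.univ : Finset (Fin R × Fin n)).card ≤ _ :=
          Finset.card_le_card fun b _ => hcon b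
        have h4 := h3.trans Finset.card_image_le
        rw [Finset.filter_or] at h4
        have h5 := h4.trans (Finset.card_union_le _ _)
        simp only [Finset.card_univ, Fintype.card_prod, Fintype.card_fin] at h5
        omega
      have hb' : ∀ e ∈ S, (src e = src a ∨ dst e = dst a) → χ e ≠ b := fun e he hc hbe =>
        hb (Finset.mem_image.2 ⟨e, Finset.mem_filter.2 ⟨he, hc⟩, hbe⟩)
      refine ⟨Function.update χ a b, fun e he e' he' hc hχe => ?_⟩
      rcases Finset.mem_insert.1 he with rfl | hes <;> rcases Finset.mem_insert.1 he' with rfl | hes'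
      · rfl
      · have hne : e' ≠ e := by rintro rfl; exact ha hes'
        rw [Function.update_self, Function.update_of_ne hne] at hχe
        exact absurd hχe.symm (hb' e' hes' (hc.imp Eq.symm Eq.symm))
      · have hne : e ≠ e' := by rintro rfl; exact ha hes
        rw [Function.update_self, Function.update_of_ne hne] at hχe
        exact absurd hχe (hb' e hes hc)
      · have hne : e ≠ a := by rintro rfl; exact ha hes
        have hne' : e' ≠ a := by rintro rfl; exact ha hes'
        rw [Function.update_of_ne hne, Function.update_of_ne hne'] at hχe
        exact hχ e hes e' hes' hc hχe
  obtain ⟨χ, hχ⟩ := key Finset.univ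
  exact ⟨χ, fun e e' h => hχ e (by simp) e' (by simp) (.inl h),
    fun e e' h => hχ e (by simp) e' (by simp) (.inr h)⟩

namespace Program

/-- Node `v` takes part in the delivery of the packets of colours `(t, h)`: the one with colour
`(t, h)` goes through the node `h`. -/
noncomputable def relay [NeZero n] {R : ℕ} (src dst : E → Fin n) (χ : E → Fin R × Fin n)
    (v : Fin n) (pay : E → Fin n) (t : Fin R) : Program n (Fin n → Fin n) :=
  (exchange fun h => pick (fun e => src e = v ∧ χ e = (t, h)) pay).bind fun a =>
    exchange fun x => pick (fun e => dst e = x ∧ χ e = (t, v)) fun e => a (src e)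

/-- Node `v`, which has the contents `pay e` of the packets `e` with source `v`, takes part in the
delivery of all packets, and returns the contents of those with destination `v`. -/
noncomputable def route [NeZero n] (R : ℕ) (src dst : E → Fin n) (v : Fin n) (pay : E → Fin n) :
    Program n (E → Fin n) :=
  open Classical in
  if h : ∃ χ : E → Fin R × Fin n, IsRouting src dst χ then
    (sequence (relay src dst h.choose v pay)).bind fun b =>
      ret fun e => if dst e = v then b (h.choose e).1 (h.choose e).2 else 0
  else ret fun _ => 0

/-- Sources of one colour are distinct, so each node sends at most one packet to the relay;
destinations are distinct, so the relay forwards at most one to each node. Every `pick` therefore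
has a unique candidate. -/
theorem runs_route [NeZero n] [Fintype E] {R : ℕ} {src dst : E → Fin n} (h : Routable R src dst)
    (pay : Fin n → E → Fin n) :
    Runs (fun v => route R src dst v (pay v)) (R * 2) fun v e =>
      if dst e = v then pay (src e) e else 0 := by
  classical
  have hχ := h.exists_isRouting
  simp only [route, dif_pos hχ]
  obtain ⟨h1, h2⟩ := hχ.choose_spec
  set χ := hχ.choose
  have hrelay : ∀ t, Runs (fun v => relay src dst χ v (pay v) t) (1 + 1) fun v h =>
      pick (fun e => dst e = v ∧ χ e = (t, h)) fun e =>
        pick (fun e' => src e' = src e ∧ χ e' = (t, h)) (pay (src e)) := fun t =>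
    (runs_exchange _).bind (runs_exchange fun v x => pick (fun e => dst e = x ∧ χ e = (t, v))
      fun e => pick (fun e' => src e' = src e ∧ χ e' = (t, v)) (pay (src e)))
  have := (runs_sequence (p := fun v => relay src dst χ v (pay v)) hrelay).bind
    (f := fun v b => ret fun e => if dst e = v then b (χ e).1 (χ e).2 else 0) (Runs.ret _)
  rw [Nat.add_zero] at this
  convert this using 4 with v e hv
  symm
  dsimp only
  rw [pick_eq (e := e) _ ⟨hv, rfl⟩ fun e' he' => h2 _ _ (he'.1.trans hv.symm) he'.2,
    pick_eq (e := e) _ ⟨rfl, rfl⟩ fun e' he' => h1 _ _ he'.1 he'.2]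

end Program

end Routing

end CongestedClique

namespace CongestedClique

/-! ### Distributed Boolean matrix product and breadth-first search -/

section ShortestPaths

variable {n : ℕ} [NeZero n] {r₁ : ℕ}

/-- The number of elements of `N` in the class `i` of the partition `ι`. -/
noncomputable def classCount (ι : Fin n → Fin r₁) (N : Set (Fin n)) (i : Fin r₁) : Fin n :=
  Fin.ofNat n (Nat.card {v // v ∈ N ∧ ι v = i})

/-- The `l`-th element of `N` in the class `i`. -/
noncomputable def classVertex (ι : Fin n → Fin r₁) (N : Set (Fin n)) (i : Fin r₁) (l : Fin n) :
    Fin n :=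
  if h : l < Nat.card {v // v ∈ N ∧ ι v = i} then ((Finite.equivFin _).symm ⟨l, h⟩).1 else 0

/-- Since `w` is missing from `N`, the count is below `n` and survives the reduction modulo `n`. -/
theorem classCount_val (ι : Fin n → Fin r₁) {N : Set (Fin n)} {w : Fin n} (hw : w ∉ N)
    (i : Fin r₁) : (classCount ι N i : ℕ) = Nat.card {v // v ∈ N ∧ ι v = i} := by
  have h : Nat.card {v // v ∈ N ∧ ι v = i} < n := by
    have := Finite.card_subtype_lt (p := fun v => v ∈ N ∧ ι v = i) (x := w) (by simp [hw])
    simpa using this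
  simp [classCount, Nat.mod_eq_of_lt h]

theorem classVertex_mem (ι : Fin n → Fin r₁) {N : Set (Fin n)} {w : Fin n} (hw : w ∉ N)
    {i : Fin r₁} {l : Fin n} (hl : l < classCount ι N i) :
    classVertex ι N i l ∈ N ∧ ι (classVertex ι N i l) = i := by
  rw [Fin.lt_def, classCount_val ι hw] at hl
  rw [classVertex, dif_pos hl]
  exact ((Finite.equivFin {v // v ∈ N ∧ ι v = i}).symm ⟨l, hl⟩).2

theorem exists_classVertex (ι : Fin n → Fin r₁) {N : Set (Fin n)} {w v : Fin n} (hw : w ∉ N)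
    (hv : v ∈ N) : ∃ l, l < classCount ι N (ι v) ∧ classVertex ι N (ι v) l = v := by
  let x := Finite.equivFin {u // u ∈ N ∧ ι u = ι v} ⟨v, hv, rfl⟩
  have hx := classCount_val ι hw (ι v)
  have hlt : (x : ℕ) < classCount ι N (ι v) := by rw [hx]; exact x.2
  refine ⟨⟨x, hlt.trans (classCount ι N (ι v)).2⟩, hlt, ?_⟩
  rw [classVertex, dif_pos x.2]
  simp [x]

/-- The edges, numbered: `(w, i, l)` stands for the `l`-th neighbour of `w` in the class `i`. -/
abbrev Slot (c : Fin n → Fin r₁ → Fin n) : Type :=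
  {e : Fin n × Fin r₁ × Fin n // e.2.2 < c e.1 e.2.1}

/-- A distribution of the work for a product of the adjacency matrix with a square matrix. The rows
of the adjacency matrix have `r₁` classes. The columns are partitioned into `r₂` classes, depending
on the class of the rows. The columns of the other matrix are partitioned into `r₃` classes. -/
structure Layout (n r₁ : ℕ) (c : Fin n → Fin r₁ → Fin n) where
  r₂ : ℕ
  r₃ : ℕ
  colClass : Fin r₁ → Fin n → Fin r₂
  tgtClass : Fin n → Fin r₃
  worker : Fin r₁ × Fin r₂ × Fin r₃ → Fin n
  holder : Slot c → Fin n

namespace Layout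

variable {c : Fin n → Fin r₁ → Fin n} (Y : Layout n r₁ c)

/-- The nodes that need an edge. -/
def slotCell (p : Slot c × Fin Y.r₃) : Fin r₁ × Fin Y.r₂ × Fin Y.r₃ :=
  (p.1.1.2.1, Y.colClass p.1.1.2.1 p.1.1.1, p.2)

/-- The nodes that need an entry of the matrix on the right. -/
def entryCell (p : Fin r₁ × Fin n × Fin n) : Fin r₁ × Fin Y.r₂ × Fin Y.r₃ :=
  (p.1, Y.colClass p.1 p.2.1, Y.tgtClass p.2.2)

/-- The nodes that contribute to an entry of the product. -/
def resultCell (ι : Fin n → Fin r₁) (p : Fin n × Fin Y.r₂ × Fin n) :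
    Fin r₁ × Fin Y.r₂ × Fin Y.r₃ :=
  (ι p.1, p.2.1, Y.tgtClass p.2.2)

/-- The four communication patterns can be handled with the parameter `R`. -/
structure Feasible (ι : Fin n → Fin r₁) (R : ℕ) : Prop where
  spread : Routable R (fun e : Slot c => e.1.1) Y.holder
  slots : Routable R (fun p : Slot c × Fin Y.r₃ => Y.holder p.1) fun p => Y.worker (Y.slotCell p)
  entries : Routable R (fun p : Fin r₁ × Fin n × Fin n => p.2.1) fun p => Y.worker (Y.entryCell p)
  results : Routable R (fun p => Y.worker (Y.resultCell ι p))
    (fun p : Fin n × Fin Y.r₂ × Fin n => p.1)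

end Layout

/-- A truth value as a message. -/
noncomputable def bit (p : Prop) : Fin n := open Classical in if p then 1 else 0

theorem bit_eq_one [Nontrivial (Fin n)] {p : Prop} : (bit p : Fin n) = 1 ↔ p := by
  unfold bit
  have h1 : n ≠ 1 := by
    rintro rfl
    exact not_subsingleton (Fin 1) inferInstance
  split_ifs with h <;> simp [h, h1]

namespace Program

open Layout

variable {c : Fin n → Fin r₁ → Fin n}

/-- The edges are sent to the nodes that need them. -/
noncomputable def distribute (ι : Fin n → Fin r₁) (Y : Layout n r₁ c) (R : ℕ) (v : Fin n)
    (N : Set (Fin n)) : Program n (Slot c × Fin Y.r₃ → Fin n) :=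
  (route R (fun e : Slot c => e.1.1) Y.holder v fun e => classVertex ι N e.1.2.1 e.1.2.2).bind
    fun a => route R (fun p : Slot c × Fin Y.r₃ => Y.holder p.1) (fun p => Y.worker (Y.slotCell p)) v
      fun p => a p.1

theorem runs_distribute {ι : Fin n → Fin r₁} {Y : Layout n r₁ c} {R : ℕ} (hY : Y.Feasible ι R)
    (N : Fin n → Set (Fin n)) :
    Runs (fun v => distribute ι Y R v (N v)) (R * 2 + R * 2) fun v p =>
      if Y.worker (Y.slotCell p) = v then classVertex ι (N p.1.1.1) p.1.1.2.1 p.1.1.2.2 else 0 := by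
  unfold distribute
  refine (runs_route hY.spread fun v e => classVertex ι (N v) e.1.2.1 e.1.2.2).bind ?_
  have := runs_route hY.slots fun v p =>
      if Y.holder p.1 = v then classVertex ι (N p.1.1.1) p.1.1.2.1 p.1.1.2.2 else 0
  simpa using this

/-- The row `v` of the Boolean product of the adjacency matrix with the matrix that has the given
row `v`. -/
noncomputable def product (ι : Fin n → Fin r₁) (Y : Layout n r₁ c) (R : ℕ) (v : Fin n)
    (b : Slot c × Fin Y.r₃ → Fin n) (row : Set (Fin n)) : Program n (Set (Fin n)) :=
  (route R (fun p : Fin r₁ × Fin n × Fin n => p.2.1) (fun p => Y.worker (Y.entryCell p)) v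
    fun p => bit (p.2.2 ∈ row)).bind fun t =>
  (route R (fun p => Y.worker (Y.resultCell ι p)) (fun p : Fin n × Fin Y.r₂ × Fin n => p.1) v
    fun p => bit (∃ e : Slot c, e.1.2.1 = ι p.1 ∧ Y.colClass e.1.2.1 e.1.1 = p.2.1 ∧
      b (e, Y.tgtClass p.2.2) = p.1 ∧ t (e.1.2.1, e.1.1, p.2.2) = 1)).bind fun s =>
  ret {u | ∃ k, s (v, k, u) = 1}

/-- Each triple (row, column, target) belongs to one cell, whose worker has both factors. A worker
takes the disjunction over the columns of its class, and the row's owner takes it over the column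
classes. -/
theorem runs_product [Nontrivial (Fin n)] {ι : Fin n → Fin r₁} {N : Fin n → Set (Fin n)}
    (hN : ∀ v, v ∉ N v) {Y : Layout n r₁ fun v => classCount ι (N v)} {R : ℕ}
    (hY : Y.Feasible ι R) (row : Fin n → Set (Fin n)) :
    Runs (fun v => product ι Y R v (fun p =>
        if Y.worker (Y.slotCell p) = v then classVertex ι (N p.1.1.1) p.1.1.2.1 p.1.1.2.2 else 0)
      (row v)) (R * 2 + R * 2) fun v => {u | ∃ w, v ∈ N w ∧ u ∈ row w} := by
  unfold product
  refine (runs_route hY.entries fun v p => bit (p.2.2 ∈ row v)).bind ?_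
  change Runs _ (R * 2 + 0) _
  refine (runs_route hY.results _).bind (Runs.ret_of_eq fun v => ?_)
  ext u
  simp only [Set.mem_ofPred_eq, if_true, bit_eq_one]
  symm
  constructor
  · rintro ⟨w, hvw, hu⟩
    obtain ⟨l, hl, hlv⟩ := exists_classVertex ι (hN w) hvw
    refine ⟨Y.colClass (ι v) w, ⟨(w, ι v, l), hl⟩, rfl, rfl, ?_, ?_⟩
    · rw [if_pos (by rfl)]
      exact hlv
    · rw [if_pos (by rfl), bit_eq_one]
      exact hu
  · rintro ⟨k, ⟨⟨w, i, l⟩, hl⟩, hi, hk, hv, hu⟩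
    dsimp only at hi hk hv hu hl
    subst hi hk
    -- The slot and the entry lie in the cell of the result, so both were delivered to this worker.
    -- The default 0, which could be mistaken for node 0, is never read.
    rw [if_pos (by rfl)] at hv hu
    rw [bit_eq_one] at hu
    refine ⟨w, ?_, hu⟩
    rw [← hv]
    exact (classVertex_mem ι (hN w) hl).1

/-- The new elements of `s` get the distance `t + 1`. -/
noncomputable def extend (t : ℕ) (d : Fin n → ℕ∞) (s : Set (Fin n)) (u : Fin n) : ℕ∞ :=
  open Classical in if d u = ⊤ ∧ u ∈ s then ((t + 1 : ℕ) : ℕ∞) else d u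

/-- Breadth-first search from all nodes, with at most `fuel` further steps. The distances up to `t`
are known; it ends with a step that changes nothing. -/
noncomputable def explore (ι : Fin n → Fin r₁) (Y : Layout n r₁ c) (R : ℕ) (v : Fin n)
    (b : Slot c × Fin Y.r₃ → Fin n) : ℕ → ℕ → (Fin n → ℕ∞) → Program n (Fin n → ℕ∞)
  | 0, _, d => ret d
  | fuel + 1, t, d =>
    open Classical in
    (product ι Y R v b {u | d u ≠ ⊤}).bind fun s =>
      (exchange fun _ => bit (extend t d s ≠ d)).bind fun f =>
        if ∃ u, f u = 1 then explore ι Y R v b fuel (t + 1) (extend t d s) else ret d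

/-- All-pairs shortest paths: the nodes announce their degrees `δ`, which determine a partition
`ι δ` of the nodes and then the number of neighbours in every class, which determine a layout. -/
noncomputable def shortestPaths (r R : (Fin n → Fin n) → ℕ) (ι : ∀ δ, Fin n → Fin (r δ))
    (Y : ∀ δ (c : Fin n → Fin (r δ) → Fin n), Layout n (r δ) c) (v : Fin n) (N : Set (Fin n)) :
    Program n (Fin n → ℕ∞) :=
  (exchange fun _ => Fin.ofNat n N.ncard).bind fun δ =>
  (sequence fun i => exchange fun _ => classCount (ι δ) N i).bind fun c =>
  (distribute (ι δ) (Y δ fun u i => c i u) (R δ) v N).bind fun b =>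
  explore (ι δ) (Y δ fun u i => c i u) (R δ) v b n 0 fun u => if u = v then 0 else ⊤

end Program

end ShortestPaths

/-! ### Truncated distances -/

section Distance

variable {n : ℕ} (G : SimpleGraph (Fin n))

/-- The distances up to `t`; the others are replaced by `⊤`. -/
noncomputable def truncDist (t : ℕ) (v u : Fin n) : ℕ∞ :=
  if G.edist v u ≤ t then G.edist v u else ⊤

variable {G}

theorem truncDist_ne_top {t : ℕ} {v u : Fin n} : truncDist G t v u ≠ ⊤ ↔ G.edist v u ≤ t := by
  unfold truncDist
  split_ifs with h
  · simpa [h] using ne_top_of_le_ne_top (ENat.natCast_ne_top t) h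
  · simpa using h

theorem edist_le_succ_iff {V : Type*} {G : SimpleGraph V} {t : ℕ} {v u : V} :
    G.edist v u ≤ (t + 1 : ℕ) ↔ G.edist v u ≤ t ∨ ∃ w, G.Adj v w ∧ G.edist w u ≤ t := by
  constructor
  · intro h
    obtain ⟨p, hp⟩ := SimpleGraph.exists_walk_of_edist_ne_top
      (ne_top_of_le_ne_top (ENat.natCast_ne_top _) h)
    rw [← hp] at h ⊢
    cases p with
    | nil => left; simp
    | cons hadj p =>
      right
      refine ⟨_, hadj, (SimpleGraph.edist_le p).trans ?_⟩
      rw [SimpleGraph.Walk.length_cons] at h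
      norm_cast at h ⊢
      omega
  · rintro (h | ⟨w, hadj, h⟩)
    · exact h.trans (by norm_cast; omega)
    · calc G.edist v u ≤ G.edist v w + G.edist w u := SimpleGraph.edist_triangle
        _ ≤ 1 + t := add_le_add (SimpleGraph.edist_eq_one_iff_adj.2 hadj).le h
        _ = (t + 1 : ℕ) := by push_cast; rw [add_comm]

theorem truncDist_zero (v u : Fin n) : truncDist G 0 v u = if u = v then 0 else ⊤ := by
  unfold truncDist
  by_cases h : u = v
  · simp [h]
  · have : G.edist v u ≠ 0 := by simpa [SimpleGraph.edist_eq_zero_iff] using Ne.symm h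
    simp [h, this]

theorem truncDist_succ (t : ℕ) (v u : Fin n) [Decidable (truncDist G t v u = ⊤ ∧
      ∃ w, v ∈ G.neighborSet w ∧ truncDist G t w u ≠ ⊤)] : truncDist G (t + 1) v u =
    if truncDist G t v u = ⊤ ∧ ∃ w, v ∈ G.neighborSet w ∧ truncDist G t w u ≠ ⊤ then
      ((t + 1 : ℕ) : ℕ∞) else truncDist G t v u := by
  have hc : (truncDist G t v u = ⊤ ∧ ∃ w, v ∈ G.neighborSet w ∧ truncDist G t w u ≠ ⊤) ↔
      ¬ G.edist v u ≤ t ∧ ∃ w, G.Adj v w ∧ G.edist w u ≤ t := by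
    rw [← truncDist_ne_top, not_not]
    refine and_congr_right fun _ => exists_congr fun w => ?_
    rw [SimpleGraph.mem_neighborSet, SimpleGraph.adj_comm, truncDist_ne_top]
  by_cases h : G.edist v u ≤ t
  · rw [if_neg fun hc' => (hc.1 hc').1 h, truncDist, if_pos (edist_le_succ_iff.2 (.inl h)), truncDist,
      if_pos h]
  · by_cases h' : ∃ w, G.Adj v w ∧ G.edist w u ≤ t
    · have h2 : G.edist v u ≤ (t + 1 : ℕ) := edist_le_succ_iff.2 (.inr h')
      rw [if_pos (hc.2 ⟨h, h'⟩), truncDist, if_pos h2]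
      refine le_antisymm h2 ?_
      rw [not_le] at h
      have := Order.add_one_le_of_lt h
      exact_mod_cast this
    · rw [if_neg fun hc' => h' (hc.1 hc').2, truncDist, if_neg, truncDist, if_neg h]
      rw [edist_le_succ_iff]
      exact fun hor => hor.elim h h'

theorem truncDist_eq_edist_of_le {t : ℕ} (h : ∀ v u, G.edist v u ≠ ⊤ → G.edist v u ≤ t) :
    truncDist G t = fun v u => G.edist v u := by
  funext v u
  unfold truncDist
  split_ifs with h'
  · rfl
  · by_contra hne
    exact h' (h v u (Ne.symm hne))

/-- A distance of at most t + s is already at most t, by induction on s: some neighbour is within t,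
so the distance is at most t + 1, and that level adds nothing. -/
theorem truncDist_eq_edist_of_succ_eq {t : ℕ} (h : truncDist G (t + 1) = truncDist G t) :
    truncDist G t = fun v u => G.edist v u := by
  have key : ∀ s v u, G.edist v u ≤ (t + s : ℕ) → G.edist v u ≤ t := by
    intro s
    induction s with
    | zero => intro v u h; simpa using h
    | succ s ih =>
      intro v u hvu
      rw [← add_assoc] at hvu
      rcases edist_le_succ_iff.1 hvu with h1 | ⟨w, hw, h1⟩
      · exact ih v u h1
      · have h2 : G.edist v u ≤ (t + 1 : ℕ) := edist_le_succ_iff.2 (.inr ⟨w, hw, ih w u h1⟩)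
        rwa [← truncDist_ne_top, h, truncDist_ne_top] at h2
  refine truncDist_eq_edist_of_le fun v u hne => ?_
  obtain ⟨s, hs⟩ := ENat.ne_top_iff_exists.1 hne
  refine key s v u ?_
  rw [← hs]
  norm_cast
  omega

theorem truncDist_card : truncDist G n = fun v u => G.edist v u := by
  refine truncDist_eq_edist_of_le fun v u hne => ?_
  have hr : G.Reachable v u := SimpleGraph.reachable_of_edist_ne_top hne
  obtain ⟨p, hp⟩ := hr.exists_isPath
  refine (SimpleGraph.edist_le p).trans ?_
  have := hp.length_lt
  rw [Fintype.card_fin] at this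
  exact_mod_cast this.le

theorem truncDist_eq_edist_of_diam_le (hG : G.Connected) {t : ℕ} (h : G.diam ≤ t) :
    truncDist G t = fun v u => G.edist v u := by
  have := hG.nonempty
  refine truncDist_eq_edist_of_le fun v u hne => ?_
  rw [← (hG.preconnected v u).coe_dist_eq_edist]
  have h1 : G.dist v u ≤ G.diam := SimpleGraph.dist_le_diam (SimpleGraph.connected_iff_ediam_ne_top.1 hG)
  exact_mod_cast h1.trans h

end Distance

/-! ### Correctness and number of steps of the search -/

namespace Program

variable {n : ℕ} [NeZero n] [Nontrivial (Fin n)] {r₁ : ℕ} {G : SimpleGraph (Fin n)}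

/-- The count includes the final product that changes nothing, hence the diameter plus one. -/
theorem runs_explore {ι : Fin n → Fin r₁} {Y : Layout n r₁ fun v => classCount ι (G.neighborSet v)}
    {R : ℕ} (hY : Y.Feasible ι R) : ∀ fuel t, t + fuel = n →
    ∃ k, Runs (fun v => explore ι Y R v (fun p => if Y.worker (Y.slotCell p) = v then
        classVertex ι (G.neighborSet p.1.1.1) p.1.1.2.1 p.1.1.2.2 else 0) fuel t (truncDist G t v))
      (k * (R * 2 + R * 2 + 1)) (fun v u => G.edist v u) ∧ (G.Connected → t ≤ G.diam → k ≤ G.diam + 1 - t)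
  | 0, t, ht => by
    refine ⟨0, ?_, fun _ _ => Nat.zero_le _⟩
    -- Without fuel, t = n, which bounds every finite distance.
    have h := truncDist_card (G := G)
    have ht' : t = n := ht
    rw [zero_mul]
    simp only [explore, ht', h]
    exact Runs.ret _
  | fuel + 1, t, ht => by
    classical
    have hp := runs_product (fun v => G.notMem_neighborSet_self) hY
      fun v => {u | truncDist G t v u ≠ ⊤}
    have hd : ∀ v, extend t (truncDist G t v)
        {u | ∃ w, v ∈ G.neighborSet w ∧ u ∈ {u | truncDist G t w u ≠ ⊤}} =
          truncDist G (t + 1) v := by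
      intro v
      funext u
      simp only [extend, Set.mem_ofPred_eq]
      rw [truncDist_succ]
      congr
    have he := runs_exchange fun (v : Fin n) (_ : Fin n) =>
      (bit (truncDist G (t + 1) v ≠ truncDist G t v) : Fin n)
    have hex : (∃ u, (bit (truncDist G (t + 1) u ≠ truncDist G t u) : Fin n) = 1) ↔
        truncDist G (t + 1) ≠ truncDist G t := by
      simp only [bit_eq_one, ne_eq, funext_iff (f := truncDist G (t + 1)), not_forall]
    obtain ⟨k, hk, hkd⟩ : ∃ k, Runs (fun v =>
        if ∃ u, (bit (truncDist G (t + 1) u ≠ truncDist G t u) : Fin n) = 1 then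
          explore ι Y R v (fun p => if Y.worker (Y.slotCell p) = v then
            classVertex ι (G.neighborSet p.1.1.1) p.1.1.2.1 p.1.1.2.2 else 0) fuel (t + 1)
              (truncDist G (t + 1) v)
        else ret (truncDist G t v)) (k * (R * 2 + R * 2 + 1)) (fun v u => G.edist v u) ∧
        (G.Connected → t ≤ G.diam → k + 1 ≤ G.diam + 1 - t) := by
      by_cases hch : truncDist G (t + 1) = truncDist G t
      · have h := truncDist_eq_edist_of_succ_eq hch
        refine ⟨0, ?_, fun _ _ => by omega⟩
        simp only [if_neg (fun h => hex.1 h hch), zero_mul]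
        exact Runs.ret_of_eq fun v => congrFun h v
      · obtain ⟨k, hk, hkd⟩ := runs_explore hY fuel (t + 1) (by omega)
        refine ⟨k, ?_, fun hG ht => ?_⟩
        · simp only [if_pos (hex.2 hch)]
          exact hk
        -- From the diameter on, the truncations are the full distances, so a step with a change has
        -- t below the diameter.
        · have hlt : ¬ G.diam ≤ t := fun hle => hch <| by
            rw [truncDist_eq_edist_of_diam_le hG hle,
              truncDist_eq_edist_of_diam_le hG (hle.trans t.le_succ)]
          have := hkd hG (by omega)
          omega
    refine ⟨k + 1, ?_, hkd⟩
    have hT : (k + 1) * (R * 2 + R * 2 + 1) =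
      (R * 2 + R * 2) + (1 + k * (R * 2 + R * 2 + 1)) := by ring
    rw [hT]
    unfold explore
    refine hp.bind ?_
    dsimp only
    simp only [hd]
    exact he.bind hk

theorem runs_shortestPaths {r R : (Fin n → Fin n) → ℕ} {ι : ∀ δ, Fin n → Fin (r δ)}
    {Y : ∀ δ (c : Fin n → Fin (r δ) → Fin n), Layout n (r δ) c} {δ : Fin n → Fin n}
    (hδ : ∀ v, (δ v : ℕ) = (G.neighborSet v).ncard)
    (hY : (Y δ fun v => classCount (ι δ) (G.neighborSet v)).Feasible (ι δ) (R δ)) :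
    ∃ k, Runs (fun v => shortestPaths r R ι Y v (G.neighborSet v))
      (1 + (r δ * 1 + (R δ * 2 + R δ * 2 + k * (R δ * 2 + R δ * 2 + 1))))
      (fun v u => G.edist v u) ∧ (G.Connected → k ≤ G.diam + 1) := by
  obtain ⟨k, hk, hkd⟩ := runs_explore hY n 0 (zero_add n)
  refine ⟨k, ?_, fun hG => by simpa using hkd hG (Nat.zero_le _)⟩
  unfold shortestPaths
  have h0 : (fun _ u => Fin.ofNat n (G.neighborSet u).ncard) = fun _ : Fin n => δ := by
    funext _ u
    rw [← hδ u]
    exact Fin.ofNat_val_eq_self _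
  have h1 := runs_exchange fun (v _ : Fin n) => Fin.ofNat n (G.neighborSet v).ncard
  rw [h0] at h1
  refine h1.bind ?_
  refine (runs_sequence fun i => runs_exchange fun v _ =>
    classCount (ι δ) (G.neighborSet v) i).bind ?_
  refine (runs_distribute hY fun v => G.neighborSet v).bind ?_
  have h2 : ∀ v, (fun u => if u = v then (0 : ℕ∞) else ⊤) = truncDist G 0 v :=
    fun v => funext fun u => (truncDist_zero v u).symm
  simp only [h2]
  exact hk

end Program

end CongestedClique

namespace CongestedClique

/-! ### Balanced partitions and the loads of the layout -/

section Counting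

variable {n : ℕ}

/-- Cut the prefix sums at the multiples of L. In a class, the prefix sums before its nodes lie in
one block of length L, so only the last node can overshoot, by at most m. -/
theorem exists_partition {r L m : ℕ} {g : Fin n → ℕ} (hg : ∀ v, g v ≤ m)
    (hsum : ∑ v, g v < L * r) :
    ∃ κ : Fin n → Fin r, ∀ i, ∑ v with κ v = i, g v ≤ L + m := by
  have hL : 0 < L := Nat.pos_of_ne_zero fun h => by simp [h] at hsum
  have hlt : ∀ v, (∑ u with u < v, g u) / L < r := fun v => Nat.div_lt_of_lt_mul <|
    (Finset.sum_le_sum_of_subset (Finset.filter_subset _ _)).trans_lt hsum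
  refine ⟨fun v => ⟨(∑ u with u < v, g u) / L, hlt v⟩, fun i => ?_⟩
  set S := Finset.univ.filter fun v => (⟨(∑ u with u < v, g u) / L, hlt v⟩ : Fin r) = i with hS
  rcases S.eq_empty_or_nonempty with h | h
  · simp [h]
  have hmem : ∀ v ∈ S, (∑ u with u < v, g u) / L = i := fun v hv => by
    rw [hS, Finset.mem_filter] at hv
    exact congrArg Fin.val hv.2
  have h1 := hmem _ (S.min'_mem h)
  have h2 := hmem _ (S.max'_mem h)
  set a := S.min' h
  set b := S.max' h
  have h3 : ∑ u with u < a, g u + ∑ v ∈ S, g v ≤ ∑ u with u < b, g u + g b := by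
    have hb : b ∉ Finset.univ.filter fun u => u < b := by simp
    rw [add_comm (∑ u with u < b, g u), ← Finset.sum_insert hb, ← Finset.sum_union]
    · refine Finset.sum_le_sum_of_subset fun v hv => ?_
      have hab : a ≤ b := S.min'_le b (S.max'_mem h)
      rw [Finset.mem_union, Finset.mem_filter] at hv
      have hvb : v ≤ b := by
        rcases hv with hv | hv
        · exact hv.2.le.trans hab
        · exact S.le_max' v hv
      rw [Finset.mem_insert, Finset.mem_filter]
      rcases hvb.eq_or_lt with h | h
      · exact .inl h
      · exact .inr ⟨Finset.mem_univ _, h⟩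
    · rw [Finset.disjoint_left]
      intro v hv hv'
      have := S.min'_le v hv'
      rw [Finset.mem_filter] at hv
      exact absurd hv.2 (not_lt.2 this)
  have h4 := Nat.div_mul_le_self (∑ u with u < a, g u) L
  have h5 := Nat.lt_div_mul_add hL (a := ∑ u with u < b, g u)
  rw [h1] at h4
  rw [h2] at h5
  have := hg b
  omega

theorem exists_balanced [NeZero n] (α : Type) [Finite α] :
    ∃ f : α → Fin n, ∀ x, Nat.card {a // f a = x} ≤ Nat.card α / n + 1 := by
  have hn : 0 < n := Nat.pos_of_neZero n
  let e := Finite.equivFin α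
  refine ⟨fun a => ⟨e a % n, Nat.mod_lt _ hn⟩, fun x => ?_⟩
  let F : {a // (⟨e a % n, Nat.mod_lt _ hn⟩ : Fin n) = x} → Fin (Nat.card α / n + 1) :=
    fun a => ⟨e a.1 / n, Nat.lt_succ_of_le (Nat.div_le_div_right (e a.1).2.le)⟩
  have hF : Function.Injective F := by
    intro a b hab
    have h1 : (e a.1 : ℕ) / n = e b.1 / n := congrArg Fin.val hab
    have h2 : (e a.1 : ℕ) % n = e b.1 % n := congrArg Fin.val (a.2.trans b.2.symm)
    apply Subtype.ext
    apply e.injective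
    apply Fin.ext
    rw [← Nat.div_add_mod (e a.1 : ℕ) n, h1, h2, Nat.div_add_mod]
  simpa using Nat.card_le_card_of_injective F hF

theorem card_fiber_comp_le {A B C : Type} [Finite A] [Finite B] {ψ : A → B} {φ : B → C} {x : C}
    {s t : ℕ} (hψ : ∀ b, Nat.card {a // ψ a = b} ≤ s) (hφ : Nat.card {b // φ b = x} ≤ t) :
    Nat.card {a // φ (ψ a) = x} ≤ t * s := by
  classical
  have := Fintype.ofFinite B
  have e : {a // φ (ψ a) = x} ≃ Σ b : {b // φ b = x}, {a // ψ a = b.1} :=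
    { toFun := fun a => ⟨⟨ψ a.1, a.2⟩, a.1, rfl⟩
      invFun := fun p => ⟨p.2.1, by rw [p.2.2]; exact p.1.2⟩
      left_inv := fun a => rfl
      right_inv := by
        rintro ⟨⟨b, hb⟩, a, ha⟩
        dsimp only at ha
        subst ha
        rfl }
  rw [Nat.card_congr e, Nat.card_sigma]
  calc ∑ b : {b // φ b = x}, Nat.card {a // ψ a = b.1} ≤ ∑ _ : {b // φ b = x}, s :=
        Finset.sum_le_sum fun b _ => hψ b
    _ = Nat.card {b // φ b = x} * s := by simp
    _ ≤ t * s := Nat.mul_le_mul_right s hφ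

theorem card_slot_le {r₁ : ℕ} {c : Fin n → Fin r₁ → Fin n} {P : Slot c → Prop}
    {F : Finset (Fin n × Fin r₁)} (h : ∀ e, P e → (e.1.1, e.1.2.1) ∈ F) :
    Nat.card {e // P e} ≤ ∑ p ∈ F, (c p.1 p.2 : ℕ) := by
  let f : {e // P e} → Σ p : F, Fin (c p.1.1 p.1.2) :=
    fun e => ⟨⟨_, h e.1 e.2⟩, ⟨e.1.1.2.2, e.1.2⟩⟩
  have hf : Function.Injective f := by
    rintro ⟨⟨⟨w, i, l⟩, h1⟩, h2⟩ ⟨⟨⟨w', i', l'⟩, h1'⟩, h2'⟩ hab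
    simp only [f, Sigma.mk.injEq, Subtype.mk.injEq, Prod.mk.injEq] at hab
    obtain ⟨⟨rfl, rfl⟩, hab⟩ := hab
    rw [heq_eq_eq, Fin.mk.injEq, Fin.val_inj] at hab
    subst hab
    rfl
  refine (Nat.card_le_card_of_injective f hf).trans ?_
  rw [Nat.card_sigma]
  simp only [Nat.card_eq_fintype_card, Fintype.card_fin]
  rw [Finset.sum_coe_sort F fun p => (c p.1 p.2 : ℕ)]

theorem card_div_eq_le {s : ℕ} (hs : 0 < s) (j : ℕ) : Nat.card {u : Fin n // (u : ℕ) / s = j} ≤ s := by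
  let f : {u : Fin n // (u : ℕ) / s = j} → Fin s := fun u => ⟨u.1 % s, Nat.mod_lt _ hs⟩
  have hf : Function.Injective f := by
    intro a b hab
    have h1 : (a.1 : ℕ) % s = b.1 % s := congrArg Fin.val hab
    have h2 : (a.1 : ℕ) / s = b.1 / s := a.2.trans b.2.symm
    apply Subtype.ext
    apply Fin.ext
    rw [← Nat.div_add_mod (a.1 : ℕ) s, h1, h2, Nat.div_add_mod]
  simpa using Nat.card_le_card_of_injective f hf

theorem card_mul_le_sum {S : Finset (Fin n)} {f g : Fin n → ℕ} {s b : ℕ} (h : ∀ v, g v = f v + s)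
    (hb : ∑ v ∈ S, g v ≤ b) : ∑ v ∈ S, f v ≤ b ∧ S.card * s ≤ b := by
  simp only [h, Finset.sum_add_distrib, Finset.sum_const, smul_eq_mul] at hb
  omega

/-- A partition of the nodes into `3 * q` classes of nearly equal size and weight. -/
theorem exists_rowClass {q : ℕ} (hq : 1 ≤ q) (hqn : q ^ 3 ≤ 8 * n) (δ : Fin n → Fin n)
    (hδ : ∑ v, (δ v : ℕ) ≤ n * q ^ 3) : ∃ ι : Fin n → Fin (3 * q), ∀ i,
      ∑ v with ι v = i, (δ v : ℕ) ≤ 10 * n * q ^ 2 ∧ Nat.card {v // ι v = i} * q ≤ 10 * n := by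
  have hn : 0 < n := by
    have := Nat.pow_le_pow_left hq 3
    omega
  -- The extra weight q ^ 3 per node makes the same partition control class sizes; the total 2 * n *
  -- q ^ 3 fits into 3 * q blocks.
  obtain ⟨ι, hι⟩ := exists_partition (r := 3 * q) (L := n * q ^ 2) (m := n + q ^ 3)
    (g := fun v => (δ v : ℕ) + q ^ 3) (fun v => Nat.add_le_add_right (δ v).2.le _) (by
      rw [Finset.sum_add_distrib]
      simp only [Finset.sum_const, Finset.card_univ, Fintype.card_fin, smul_eq_mul]
      have : 0 < n * q ^ 3 := by positivity
      calc _ ≤ n * q ^ 3 + n * q ^ 3 := Nat.add_le_add_right hδ _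
        _ < 3 * (n * q ^ 3) := by omega
        _ = n * q ^ 2 * (3 * q) := by ring)
  refine ⟨ι, fun i => ?_⟩
  have hb : n * q ^ 2 + (n + q ^ 3) ≤ 10 * n * q ^ 2 := by
    have : n * 1 ≤ n * q ^ 2 := Nat.mul_le_mul_left n (Nat.one_le_pow _ _ hq)
    nlinarith
  have h := card_mul_le_sum (fun _ => rfl) ((hι i).trans hb)
  refine ⟨h.1, ?_⟩
  rw [Nat.card_eq_fintype_card, Fintype.card_subtype]
  refine Nat.le_of_mul_le_mul_right (c := q ^ 2) ?_ (by positivity)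
  calc _ = _ * q ^ 3 := by ring
    _ ≤ _ := h.2

/-- A partition of the columns into `12 * q` classes of nearly equal size and weight. -/
theorem exists_colClass {q : ℕ} (hq : 1 ≤ q) (hqn : q ^ 3 ≤ 8 * n) (a : Fin n → Fin n)
    (ha : ∑ w, (a w : ℕ) ≤ 10 * n * q ^ 2) : ∃ κ : Fin n → Fin (12 * q), ∀ k,
      ∑ w with κ w = k, (a w : ℕ) ≤ 10 * n * q ∧ Nat.card {w // κ w = k} * q ^ 2 ≤ 10 * n * q := by
  have hn : 0 < n := by
    have := Nat.pow_le_pow_left hq 3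
    omega
  -- The extra weight q ^ 2 again controls sizes; the total 11 * n * q ^ 2 fits into 12 * q blocks.
  obtain ⟨κ, hκ⟩ := exists_partition (r := 12 * q) (L := n * q) (m := n + q ^ 2)
    (g := fun w => (a w : ℕ) + q ^ 2) (fun w => Nat.add_le_add_right (a w).2.le _) (by
      rw [Finset.sum_add_distrib]
      simp only [Finset.sum_const, Finset.card_univ, Fintype.card_fin, smul_eq_mul]
      have : 0 < n * q ^ 2 := by positivity
      calc _ ≤ 10 * n * q ^ 2 + n * q ^ 2 := Nat.add_le_add_right ha _
        _ < 12 * (n * q ^ 2) := by nlinarith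
        _ = n * q * (12 * q) := by ring)
  refine ⟨κ, fun k => ?_⟩
  have hb : n * q + (n + q ^ 2) ≤ 10 * n * q := by
    have h1 : n * 1 ≤ n * q := Nat.mul_le_mul_left n hq
    have h2 : q ^ 2 ≤ q ^ 3 := Nat.pow_le_pow_right hq (by norm_num)
    nlinarith
  have h := card_mul_le_sum (fun _ => rfl) ((hκ k).trans hb)
  rw [Nat.card_eq_fintype_card, Fintype.card_subtype]
  exact h

theorem exists_feasible [NeZero n] {q : ℕ} (hq : 1 ≤ q) (hqn : q ^ 3 ≤ 8 * n)
    {ι : Fin n → Fin (3 * q)} (hι : ∀ i, Nat.card {v // ι v = i} * q ≤ 10 * n)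
    {c : Fin n → Fin (3 * q) → Fin n} (hrow : ∀ i, ∑ w, (c w i : ℕ) ≤ 10 * n * q ^ 2)
    (hcol : ∀ w, ∑ i, (c w i : ℕ) ≤ n) (htot : ∑ w, ∑ i, (c w i : ℕ) ≤ n * q ^ 3) :
    ∃ Y : Layout n (3 * q) c, Y.Feasible ι (6500 * q) := by
  have hn : 0 < n := Nat.pos_of_neZero n
  have hq2 : 0 < q ^ 2 := by positivity
  have hq23 : q ^ 2 ≤ q ^ 3 := Nat.pow_le_pow_right hq (by norm_num)
  have hqnq : n ≤ n * q := Nat.le_mul_of_pos_right n hq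
  choose κ hκ using fun i => exists_colClass hq hqn (fun w => c w i) (hrow i)
  have hdiv := Nat.mul_div_le n (q ^ 2)
  obtain ⟨worker, hworker⟩ := exists_balanced (n := n)
    (Fin (3 * q) × Fin (12 * q) × Fin (n / q ^ 2 + 1))
  obtain ⟨holder, hholder⟩ := exists_balanced (n := n) (Slot c)
  -- There are 36 * q ^ 2 * (n / q ^ 2 + 1) ≤ 36 * n + 36 * (8 * n) = 324 * n cells; rounding adds
  -- one per node.
  replace hworker : ∀ x, Nat.card {p // worker p = x} ≤ 325 := by
    intro x
    refine (hworker x).trans ?_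
    simp only [Nat.card_eq_fintype_card, Fintype.card_prod, Fintype.card_fin]
    rw [Nat.add_le_add_iff_right (n := 1) (k := 324), Nat.div_le_iff_le_mul_add_pred hn]
    nlinarith
  replace hholder : ∀ x, Nat.card {e // holder e = x} ≤ q ^ 3 + 1 := by
    intro x
    refine (hholder x).trans (Nat.add_le_add_right (Nat.div_le_of_le_mul ?_) 1)
    have h1 : Nat.card (Slot c) = Nat.card {e : Slot c // True} :=
      Nat.card_congr (Equiv.subtypeUnivEquiv fun _ => trivial).symm
    rw [h1]
    refine (card_slot_le (F := Finset.univ) fun _ _ => Finset.mem_univ _).trans ?_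
    rw [Fintype.sum_prod_type]
    exact htot
  let Y : Layout n (3 * q) c :=
    { r₂ := 12 * q
      r₃ := n / q ^ 2 + 1
      colClass := κ
      tgtClass := fun u => ⟨u / q ^ 2, Nat.lt_succ_of_le (Nat.div_le_div_right u.2.le)⟩
      worker := worker
      holder := holder }
  have htgt : ∀ j, Nat.card {u // Y.tgtClass u = j} ≤ q ^ 2 := by
    intro j
    refine le_trans (le_of_eq ?_) (card_div_eq_le (n := n) hq2 j)
    exact Nat.card_congr (Equiv.subtypeEquivRight fun u => Fin.ext_iff)
  -- A node works for 325 cells, each with at most 10 * n * q packets.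
  have hload : ∀ {A : Type} [Finite A] {ψ : A → Fin (3 * q) × Fin Y.r₂ × Fin Y.r₃},
      (∀ b, Nat.card {a // ψ a = b} ≤ 10 * n * q) →
      ∀ x, Nat.card {a // Y.worker (ψ a) = x} ≤ 3250 * n * q := by
    intro A _ ψ h x
    refine (card_fiber_comp_le h (hworker x)).trans (le_of_eq ?_)
    ring
  have hL : 2 * (3250 * n * q) ≤ 6500 * q * n := le_of_eq (by ring)
  refine ⟨Y, ⟨3250 * n * q, hL, fun w => ?_, fun x => ?_⟩,
    ⟨3250 * n * q, hL, fun x => ?_, hload ?_⟩, ⟨3250 * n * q, hL, fun w => ?_, hload ?_⟩,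
    ⟨3250 * n * q, hL, hload ?_, fun v => ?_⟩⟩
  · refine (card_slot_le (F := {w} ×ˢ Finset.univ) fun e he => by simp [he]).trans ?_
    rw [Finset.sum_product, Finset.sum_singleton]
    have := hcol w
    nlinarith
  · have := hholder x
    change Nat.card {e // holder e = x} ≤ _
    nlinarith
  -- Every slot is copied to all target classes. Without the holders, a node of degree near n would
  -- send about n * n / q ^ 2 packets; a holder has only q ^ 3 + 1 slots to copy.
  · have h1 : ∀ e : Slot c, Nat.card {p : Slot c × Fin Y.r₃ // p.1 = e} ≤ Y.r₃ := by
      intro e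
      let f : {p : Slot c × Fin Y.r₃ // p.1 = e} → Fin Y.r₃ := fun p => p.1.2
      have hf : Function.Injective f := fun a b hab =>
        Subtype.ext (Prod.ext (a.2.trans b.2.symm) hab)
      simpa using Nat.card_le_card_of_injective f hf
    refine (card_fiber_comp_le h1 (hholder x)).trans ?_
    change (q ^ 3 + 1) * (n / q ^ 2 + 1) ≤ _
    have h2 : q ^ 3 * (n / q ^ 2) ≤ n * q := by
      calc q ^ 3 * (n / q ^ 2) = q ^ 2 * (n / q ^ 2) * q := by ring
        _ ≤ n * q := Nat.mul_le_mul_right q hdiv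
    have h3 : n / q ^ 2 ≤ n := Nat.div_le_self _ _
    nlinarith
  · rintro ⟨i, k, j⟩
    let f : {p : Slot c × Fin Y.r₃ // Y.slotCell p = (i, k, j)} →
      {e : Slot c // e.1.2.1 = i ∧ κ e.1.2.1 e.1.1 = k} := fun p =>
        ⟨p.1.1, congrArg Prod.fst p.2, congrArg (fun t => t.2.1) p.2⟩
    have hf : Function.Injective f := by
      intro a b hab
      have h1 : a.1.2 = j := congrArg (fun t => t.2.2) a.2
      have h2 : b.1.2 = j := congrArg (fun t => t.2.2) b.2
      exact Subtype.ext (Prod.ext (congrArg Subtype.val hab) (h1.trans h2.symm))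
    refine (Nat.card_le_card_of_injective f hf).trans ?_
    refine (card_slot_le (F := (Finset.univ.filter fun w => κ i w = k) ×ˢ {i})
      fun e he => ?_).trans ?_
    · obtain ⟨rfl, h⟩ := he
      simp [h]
    · rw [Finset.sum_product]
      simp only [Finset.sum_singleton]
      exact (hκ i k).1
  · let f : {p : Fin (3 * q) × Fin n × Fin n // p.2.1 = w} → Fin (3 * q) × Fin n :=
      fun p => (p.1.1, p.1.2.2)
    have hf : Function.Injective f := by
      rintro ⟨⟨a, b, c⟩, h⟩ ⟨⟨a', b', c'⟩, h'⟩ hab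
      simp only [f, Prod.mk.injEq] at hab h h' ⊢
      simp [hab.1, hab.2, h, h']
    refine (Nat.card_le_card_of_injective f hf).trans ?_
    simp only [Nat.card_eq_fintype_card, Fintype.card_prod, Fintype.card_fin]
    nlinarith
  · rintro ⟨i, k, j⟩
    let f : {p // Y.entryCell p = (i, k, j)} → {w // κ i w = k} × {u // Y.tgtClass u = j} :=
      fun p => (⟨p.1.2.1, by
        have h1 : p.1.1 = i := congrArg Prod.fst p.2
        have h2 : κ p.1.1 p.1.2.1 = k := congrArg (fun t => t.2.1) p.2
        rwa [h1] at h2⟩, ⟨p.1.2.2, congrArg (fun t => t.2.2) p.2⟩)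
    have hf : Function.Injective f := by
      intro a b hab
      have h1 : a.1.1 = i := congrArg Prod.fst a.2
      have h2 : b.1.1 = i := congrArg Prod.fst b.2
      have h3 : a.1.2.1 = b.1.2.1 := congrArg (fun t => t.1.1) hab
      have h4 : a.1.2.2 = b.1.2.2 := congrArg (fun t => t.2.1) hab
      exact Subtype.ext (Prod.ext (h1.trans h2.symm) (Prod.ext h3 h4))
    refine (Nat.card_le_card_of_injective f hf).trans ?_
    rw [Nat.card_prod]
    exact (Nat.mul_le_mul_left _ (htgt j)).trans (hκ i k).2
  · rintro ⟨i, k, j⟩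
    let f : {p // Y.resultCell ι p = (i, k, j)} → {v // ι v = i} × {u // Y.tgtClass u = j} :=
      fun p => (⟨p.1.1, congrArg Prod.fst p.2⟩, ⟨p.1.2.2, congrArg (fun t => t.2.2) p.2⟩)
    have hf : Function.Injective f := by
      intro a b hab
      have h1 : a.1.2.1 = k := congrArg (fun t => t.2.1) a.2
      have h2 : b.1.2.1 = k := congrArg (fun t => t.2.1) b.2
      have h3 : a.1.1 = b.1.1 := congrArg (fun t => t.1.1) hab
      have h4 : a.1.2.2 = b.1.2.2 := congrArg (fun t => t.2.1) hab
      exact Subtype.ext (Prod.ext h3 (Prod.ext (h1.trans h2.symm) h4))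
    refine (Nat.card_le_card_of_injective f hf).trans ?_
    rw [Nat.card_prod]
    calc _ ≤ Nat.card {v // ι v = i} * q ^ 2 := Nat.mul_le_mul_left _ (htgt j)
      _ = Nat.card {v // ι v = i} * q * q := by ring
      _ ≤ _ := Nat.mul_le_mul_right q (hι i)
  · let f : {p : Fin n × Fin Y.r₂ × Fin n // p.1 = v} → Fin (12 * q) × Fin n :=
      fun p => p.1.2
    have hf : Function.Injective f := fun a b hab =>
      Subtype.ext (Prod.ext (a.2.trans b.2.symm) hab)
    refine (Nat.card_le_card_of_injective f hf).trans ?_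
    simp only [Nat.card_eq_fintype_card, Fintype.card_prod, Fintype.card_fin]
    nlinarith

end Counting

end CongestedClique

namespace CongestedClique

/-! ### Degree sums, the choice of q, and the total number of rounds -/

section Degrees

variable {n : ℕ} (G : SimpleGraph (Fin n))

open Classical in
theorem ncard_neighborSet_eq_sum (v : Fin n) :
    (G.neighborSet v).ncard = ∑ w, if G.Adj v w then 1 else 0 := by
  rw [Finset.sum_boole, ← Nat.card_coe_set_eq, Nat.card_eq_fintype_card,
    Fintype.card_subtype]
  simp

open Classical in
theorem classCount_eq_sum [NeZero n] {r₁ : ℕ} (ι : Fin n → Fin r₁) (w : Fin n) (i : Fin r₁) :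
    (classCount ι (G.neighborSet w) i : ℕ) =
      ∑ v with ι v = i, if G.Adj w v then 1 else 0 := by
  rw [classCount_val ι G.notMem_neighborSet_self, Finset.sum_boole, Finset.filter_filter,
    Nat.card_eq_fintype_card, Fintype.card_subtype]
  simp [and_comm]

theorem sum_classCount [NeZero n] {r₁ : ℕ} (ι : Fin n → Fin r₁) (w : Fin n) :
    ∑ i, (classCount ι (G.neighborSet w) i : ℕ) = (G.neighborSet w).ncard := by
  classical
  simp only [classCount_eq_sum, ncard_neighborSet_eq_sum]
  exact Finset.sum_fiberwise _ _ _

/-- Double counting, by symmetry of adjacency: this turns the degree balance of the row classes into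
a bound on their slots. -/
theorem sum_classCount_eq_sum_degree [NeZero n] {r₁ : ℕ} (ι : Fin n → Fin r₁) (i : Fin r₁) :
    ∑ w, (classCount ι (G.neighborSet w) i : ℕ) = ∑ v with ι v = i, (G.neighborSet v).ncard := by
  classical
  simp only [classCount_eq_sum, ncard_neighborSet_eq_sum]
  rw [Finset.sum_comm]
  simp only [SimpleGraph.adj_comm]

theorem sum_ncard_neighborSet : ∑ v, (G.neighborSet v).ncard = 2 * G.edgeSet.ncard := by
  classical
  rw [← SimpleGraph.coe_edgeFinset, Set.ncard_coe_finset, ← G.sum_degrees_eq_twice_card_edges]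
  refine Finset.sum_congr rfl fun v _ => ?_
  rw [← Nat.card_coe_set_eq, Nat.card_eq_fintype_card, SimpleGraph.card_neighborSet_eq_degree]

end Degrees

/-- Take the least q; q = n is admissible. Minimality gives the last bound, hence (q - 1) ^ 3 ≤ n,
and q ≤ 2 * (q - 1) unless q = 1. -/
theorem exists_cube_bound {n M : ℕ} (hn : 0 < n) (hM : M ≤ n * n) :
    ∃ q, 1 ≤ q ∧ q ^ 3 ≤ 8 * n ∧ M ≤ n * q ^ 3 ∧ n * (q - 1) ^ 3 ≤ M := by
  classical
  have hex : ∃ q, 1 ≤ q ∧ M ≤ n * q ^ 3 :=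
    ⟨n, hn, hM.trans (Nat.mul_le_mul_left n (Nat.le_self_pow (by norm_num) n))⟩
  obtain ⟨h1, h2⟩ := Nat.find_spec hex
  have hmin : ∀ p, p < Nat.find hex → ¬ (1 ≤ p ∧ M ≤ n * p ^ 3) := fun p => Nat.find_min hex
  generalize Nat.find hex = q at h1 h2 hmin
  have h3 : n * (q - 1) ^ 3 ≤ M := by
    rcases h1.eq_or_lt with rfl | h
    · simp
    · have := hmin (q - 1) (by omega)
      rw [not_and, not_le] at this
      exact (this (by omega)).le
  refine ⟨q, h1, ?_, h2, h3⟩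
  obtain ⟨p, rfl⟩ : ∃ p, q = p + 1 := ⟨q - 1, by omega⟩
  rw [Nat.add_sub_cancel] at h3
  have h4 : p ^ 3 ≤ n := Nat.le_of_mul_le_mul_left (h3.trans hM) hn
  rcases Nat.eq_zero_or_pos p with rfl | hp
  · omega
  · calc (p + 1) ^ 3 ≤ (2 * p) ^ 3 := Nat.pow_le_pow_left (by omega) 3
      _ = 8 * p ^ 3 := by ring
      _ ≤ 8 * n := Nat.mul_le_mul_left 8 h4

theorem one_le_diam {V : Type*} [Finite V] [Nontrivial V] {G : SimpleGraph V}
    (hG : G.Connected) : 1 ≤ G.diam := by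
  obtain ⟨v, u, hvu⟩ := exists_pair_ne V
  exact (Nat.succ_le_of_lt (hG.pos_dist_of_ne hvu)).trans
    (SimpleGraph.dist_le_diam (SimpleGraph.connected_iff_ediam_ne_top.1 hG))

/-- Partition and layout are chosen as functions of the announced numbers, before the graph, so the
nodes agree on them without further communication. -/
theorem exists_program (n : ℕ) [NeZero n] [Nontrivial (Fin n)] :
    ∃ p : Fin n → Set (Fin n) → Program n (Fin n → ℕ∞), ∀ G : SimpleGraph (Fin n), ∃ T,
      Program.Runs (fun v => p v (G.neighborSet v)) T (fun v u => G.edist v u) ∧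
      (G.Connected → ∃ q, 1 ≤ q ∧ n * (q - 1) ^ 3 ≤ 2 * G.edgeSet.ncard ∧
        T ≤ 80000 * q * G.diam) := by
  classical
  have hn : 0 < n := Nat.pos_of_neZero n
  have hM : ∀ δ : Fin n → Fin n, ∑ v, (δ v : ℕ) ≤ n * n := fun δ => by
    simpa using Finset.sum_le_sum fun v (_ : v ∈ Finset.univ) => (δ v).2.le
  choose q hq1 hq8 hqM hqle using fun δ : Fin n → Fin n => exists_cube_bound hn (hM δ)
  choose ι hιδ hι using fun δ => exists_rowClass (hq1 δ) (hq8 δ) δ (hqM δ)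
  have hY : ∀ δ (c : Fin n → Fin (3 * q δ) → Fin n), ∃ Y : Layout n (3 * q δ) c,
      (∃ Z : Layout n (3 * q δ) c, Z.Feasible (ι δ) (6500 * q δ)) →
        Y.Feasible (ι δ) (6500 * q δ) := fun δ c => by
    by_cases h : ∃ Z : Layout n (3 * q δ) c, Z.Feasible (ι δ) (6500 * q δ)
    · exact ⟨h.choose, fun _ => h.choose_spec⟩
    -- Counts that come from no graph may have no feasible layout; an arbitrary one serves there.
    · exact ⟨⟨1, 1, 0, 0, 0, 0⟩, fun h' => absurd h' h⟩
  choose Y hY using hY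
  refine ⟨Program.shortestPaths (fun δ => 3 * q δ) (fun δ => 6500 * q δ) ι Y, fun G => ?_⟩
  let δ : Fin n → Fin n := fun v => ⟨(G.neighborSet v).ncard, by
    have := Set.ncard_lt_card (s := G.neighborSet v) (Set.ne_univ_iff_exists_notMem _ |>.2
      ⟨v, G.notMem_neighborSet_self⟩)
    simpa using this⟩
  have hδ : ∀ v, (δ v : ℕ) = (G.neighborSet v).ncard := fun _ => rfl
  have hF := hY δ (fun v => classCount (ι δ) (G.neighborSet v)) <|
    exists_feasible (hq1 δ) (hq8 δ) (hι δ)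
      (fun i => by rw [sum_classCount_eq_sum_degree]; exact hιδ δ i)
      (fun w => by rw [sum_classCount, ← hδ]; exact (δ w).2.le)
      (by simp only [sum_classCount, ← hδ]; exact hqM δ)
  obtain ⟨k, hk, hkd⟩ := Program.runs_shortestPaths (r := fun δ => 3 * q δ)
    (R := fun δ => 6500 * q δ) (ι := ι) (Y := Y) hδ hF
  refine ⟨_, hk, fun hG => ⟨q δ, hq1 δ, ?_, ?_⟩⟩
  · rw [← sum_ncard_neighborSet]
    exact hqle δ
  · have h1 := hkd hG
    -- With D ≥ 1, the rounds number at most 1 + 3q + 26000q + 2D(26000q + 1) ≤ 78006qD.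
    have hD := one_le_diam hG
    have hq := hq1 δ
    have h2 : k ≤ 2 * G.diam := by omega
    have h3 : q δ ≤ q δ * G.diam := Nat.le_mul_of_pos_right _ hD
    have h4 : k * q δ ≤ 2 * G.diam * q δ := Nat.mul_le_mul_right _ h2
    have h5 : G.diam ≤ q δ * G.diam := Nat.le_mul_of_pos_left _ hq
    nlinarith

theorem cube_root_bound {n m q D T : ℕ} (hn : 0 < n) (hq : 1 ≤ q)
    (hqm : n * (q - 1) ^ 3 ≤ 2 * m) (hT : T ≤ 80000 * q * D) :
    (T : ℝ) ≤ 160000 * ((D : ℝ) * (((m : ℝ) / (n : ℝ)) ^ ((1 : ℝ) / 3) + 1)) := by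
  obtain ⟨p, rfl⟩ : ∃ p, q = p + 1 := ⟨q - 1, by omega⟩
  rw [Nat.add_sub_cancel] at hqm
  have hn' : (0 : ℝ) < n := by exact_mod_cast hn
  set x : ℝ := ((m : ℝ) / (n : ℝ)) ^ ((1 : ℝ) / 3) with hx
  have hx0 : 0 ≤ x := by positivity
  have hx3 : x ^ 3 = m / n := by
    rw [hx, ← Real.rpow_natCast, ← Real.rpow_mul (by positivity)]
    norm_num
  -- The cube root of 2, from the degree sum 2m, is rounded up to 2.
  have hp : (p : ℝ) ≤ 2 * x := by
    refine le_of_pow_le_pow_left₀ (n := 3) (by norm_num) (by positivity) ?_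
    have h1 : (n : ℝ) * (p : ℝ) ^ 3 ≤ 2 * m := by exact_mod_cast hqm
    have h2 : (p : ℝ) ^ 3 ≤ 2 * x ^ 3 := by
      rw [hx3, ← mul_div_assoc, le_div_iff₀ hn']
      linarith
    have h3 : 0 ≤ x ^ 3 := by positivity
    calc (p : ℝ) ^ 3 ≤ 2 * x ^ 3 := h2
      _ ≤ (2 * x) ^ 3 := by ring_nf; linarith
  have hT' : (T : ℝ) ≤ 80000 * ((p : ℝ) + 1) * D := by exact_mod_cast hT
  have hD : (0 : ℝ) ≤ D := Nat.cast_nonneg D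
  calc (T : ℝ) ≤ 80000 * ((p : ℝ) + 1) * D := hT'
    _ ≤ 80000 * (2 * (x + 1)) * D := by gcongr; linarith
    _ = 160000 * ((D : ℝ) * (x + 1)) := by ring

theorem exists_algorithm (n : ℕ) :
    ∃ A : Algorithm n (1 * Nat.clog 2 n) (Set (Fin n)) (Fin n → ℕ∞),
      ∀ G : SimpleGraph (Fin n), ∃ T : ℕ,
        A.ComputesWithin (fun v => G.neighborSet v) (fun v u => G.edist v u) T ∧
        (G.Connected → (T : ℝ) ≤
          160000 * ((G.diam : ℝ) * (((G.edgeSet.ncard : ℝ) / (n : ℝ)) ^ ((1 : ℝ) / 3) + 1))) := by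
  rcases subsingleton_or_nontrivial (Fin n) with hs | hs
  -- A single node has diameter 0, so the bound leaves no round at all; moreover the encoding of
  -- bits needs 0 ≠ 1 in `Fin n`.
  · refine ⟨⟨Unit, fun _ _ => (), fun _ _ => ⟨[], Nat.zero_le _⟩, fun _ _ => (),
      fun _ => some fun _ => 0⟩, fun G => ⟨0, fun v => ?_, fun _ => ?_⟩⟩
    · refine congrArg some (funext fun u => ?_)
      rw [Subsingleton.elim u v]
      exact SimpleGraph.edist_self.symm
    · rw [Nat.cast_zero]
      positivity
  · have hn : 0 < n := (Classical.arbitrary (Fin n)).pos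
    have : NeZero n := ⟨hn.ne'⟩
    obtain ⟨enc, dec, hdec⟩ := exists_encoding n
    obtain ⟨p, hp⟩ := exists_program n
    refine ⟨Program.toAlgorithm enc dec p, fun G => ?_⟩
    obtain ⟨T, hT, hb⟩ := hp G
    refine ⟨T, hT.computesWithin hdec, fun hG => ?_⟩
    obtain ⟨q, hq, hqm, hTq⟩ := hb hG
    exact cube_root_bound hn hq hqm hTq

end CongestedClique

theorem theorem3 :
    ∃ (c : ℕ) (C : ℝ)
      (A : ∀ n : ℕ, CongestedClique.Algorithm n (c * Nat.clog 2 n) (Set (Fin n)) (Fin n → ℕ∞)),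
      ∀ (n : ℕ) (G : SimpleGraph (Fin n)),
        ∃ T : ℕ,
          (A n).ComputesWithin (fun v => G.neighborSet v) (fun v u => G.edist v u) T ∧
          (G.Connected →
            (T : ℝ) ≤
              C * ((G.diam : ℝ) * (((G.edgeSet.ncard : ℝ) / (n : ℝ)) ^ ((1 : ℝ) / 3) + 1))) := by
  choose A hA using CongestedClique.exists_algorithm
  exact ⟨1, 160000, A, hA⟩
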